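/- **Setting.** Let $\mathbb F$ be a finite field. A distributed storage system stores $f\ge 1$ files $X^{(1)},\dots,X^{(f)}$, each a $\beta\times k$ matrix whose entries are all independent and uniform on $\mathbb F$. With a generator matrix $G$ (a $k\times n$ matrix over $\mathbb F$ with linearly independent rows) of an $[n,k]$ linear code $\mathcal C$, each of the $\beta$ rows (stripes) of each file is encoded into a codeword, and node $l\in\{1,\dots,n\}$ stores the $l$-th coordinate of all the codewords, i.e. the $l$-th column of $X^{(j)}G$ for $j=1,\dots,f$. To retrieve file $m$ the user draws random queries $Q^{(m)}_1,\dots,Q^{(m)}_n$, independent of the files, and node $l$ returns $A^{(m)}_l\in\mathbb F^{d_l}$, a deterministic function of $Q^{(m)}_l$ and of the symbols stored in node $l$; the numbers $d_l$ are fixed. The scheme achieves perfect PIR if it satisfies the privacy condition $I\bigl(m;Q^{(m)}_l,A^{(m)}_l,X^{(1)},\dots,X^{(f)}\bigr)=0$ for all $l$ (for every distribution of $m$) and the recovery condition $H\bigl(X^{(m)}\mid A^{(m)}_1,\dots,A^{(m)}_n,Q^{(m)}_1,\dots,Q^{(m)}_n\bigr)=0$ for all $m$. Its PIR rate is $\beta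 k/D$, where $D=\sum_l d_l$ is the total number of downloaded symbols. A rate $R$ is *achievable* (for $f$ files) if for some $\beta\ge1$ there is a perfect PIR scheme of rate $R$. It is *achievable by a file-independent protocol* if there are $\beta\ge 1$ and $d_1,\dots,d_n$, not depending on $f$, with $\beta k/\sum_l d_l=R$, such that for every $f\ge1$ a perfect PIR scheme for $f$ files with these parameters exists. An *information set* of an $[n,k]$ code is a set of $k$ coordinates such that the corresponding $k\times k$ submatrix of a generator matrix is invertible. An $[n,k]$ code is *MDS-PIR capacity-achieving* if for some $\kappa$ and $\nu\ge1$ with $\kappa/\nu=k/n$ there is a binary $\nu\times n$ matrix all of whose columns have Hamming weight $\kappa$ and such that the support of each of its rows contains an information set of the code. For $1\le k<n$ put $$C_f^{[n,k]}=\frac{n-k}{n}\Bigl[1-\Bigl(\frac kn\Bigr)^f\Bigr]^{-1},\qquad C_\infty^{[n,k]}=\lim_{f\to\infty}C_f^{[n,k]}=\frac{n-k}{n},$$ and put $C_f^{[n,n]}=1/f$. Two codes are *isometric* if some linear bijection of their ambient spaces that preserves the Hamming weight maps one onto the other. **Theorem.** Let $P\ge1$ and, for $p=1,\dots,P$, let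 $G_p$ be a generator matrix of an MDS-PIR capacity-achieving $[n_p,k_p]$ code with $k_p\ge1$. Let $\mathcal C$ be an $[n,k]$ code over $\mathbb F$ that is isometric to the direct sum of these codes, i.e. to the code generated by the block diagonal matrix $\operatorname{diag}(G_1,\dots,G_P)$, and let $G$ be any generator matrix of $\mathcal C$. Then, for the storage system that uses $\mathcal C$ (with generator matrix $G$): 1. for every $f\ge1$ the PIR rate $$R_{f,\mathsf B}(\mathcal C)=\Bigl(\sum_{p=1}^P\frac{k_p}{k}\bigl(C_f^{[n_p,k_p]}\bigr)^{-1}\Bigr)^{-1}$$ is achievable for $f$ files; 2. if moreover $k_p<n_p$ for all $p$, then $$\lim_{f\to\infty}R_{f,\mathsf B}(\mathcal C)=R_{\infty,\mathsf B}(\mathcal C):=\Bigl(\sum_{p=1}^P\frac{k_p}{k}\bigl(C_\infty^{[n_p,k_p]}\bigr)^{-1}\Bigr)^{-1},$$ and the PIR rate $R_{\infty,\mathsf B}(\mathcal C)$ is achievable by a file-independent protocol. -/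

import Mathlib

open Filter Topology

universe u v w

noncomputable section

/-! ## Entropy of finitely-valued random variables -/

namespace FiniteEntropy

variable {Ω : Type u} {α : Type v} {γ : Type w} [Fintype α] [Fintype γ]

/-- Shannon entropy `H(X)` (in nats) of a finitely-valued random variable `X` on the discrete
probability space `(Ω, p)`. -/
def entropy (p : PMF Ω) (X : Ω → α) : ℝ :=
  ∑ a, Real.negMulLog ((p.map X) a).toReal

/-- Conditional entropy `H(X | Y) = H(X, Y) - H(Y)`. -/
def condEntropy (p : PMF Ω) (X : Ω → α) (Y : Ω → γ) : ℝ :=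
  entropy p (fun ω => (X ω, Y ω)) - entropy p Y

/-- Mutual information `I(X; Y) = H(X) + H(Y) - H(X, Y)`. -/
def mutualInfo (p : PMF Ω) (X : Ω → α) (Y : Ω → γ) : ℝ :=
  entropy p X + entropy p Y - entropy p (fun ω => (X ω, Y ω))

end FiniteEntropy

/-! ## Linear codes -/

namespace LinCode

variable {F : Type u} [Field F]

/-- The linear code generated by the rows of `G`. -/
def code {r : Type v} {ι : Type w} (G : Matrix r ι F) : Submodule F (ι → F) :=
  Submodule.span F (Set.range G.row)

/-- `G` is a generator matrix of an `[n, k]` code: its `k` rows are linearly independent. -/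
def IsGenerator {k n : ℕ} (G : Matrix (Fin k) (Fin n) F) : Prop :=
  LinearIndependent F G.row

open Classical in
/-- Two codes are (linearly) isometric if a linear bijection of the ambient spaces that preserves
the Hamming weight maps one onto the other. -/
def Isometric {ι : Type v} {ι' : Type w} [Fintype ι] [Fintype ι']
    (C : Submodule F (ι → F)) (D : Submodule F (ι' → F)) : Prop :=
  ∃ φ : (ι → F) ≃ₗ[F] (ι' → F),
    (∀ x, hammingNorm (φ x) = hammingNorm x) ∧ C.map (φ : (ι → F) →ₗ[F] (ι' → F)) = D

/-- `I` is an information set: `|I| = k` and the `k × k` matrix formed by the columns of `G`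
indexed by `I` (listed in some order) is invertible. -/
def IsInformationSet {k n : ℕ} (G : Matrix (Fin k) (Fin n) F) (I : Finset (Fin n)) : Prop :=
  ∃ e : Fin k ≃ I, IsUnit (G.submatrix id (fun j => (e j : Fin n)))

/-- `Λ` is a PIR achievable rate matrix: a binary `ν × n` matrix all of whose columns have Hamming
weight `κ`, and such that the support of each row contains an information set. -/
def IsPIRAchievableRateMatrix {k n κ ν : ℕ} (G : Matrix (Fin k) (Fin n) F)
    (Λ : Matrix (Fin ν) (Fin n) (ZMod 2)) : Prop :=
  (∀ l, (Finset.univ.filter fun i => Λ i l ≠ 0).card = κ) ∧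
    ∀ i, ∃ I : Finset (Fin n), IsInformationSet G I ∧ ∀ l ∈ I, Λ i l ≠ 0

/-- The `[n, k]` code generated by `G` is MDS-PIR capacity-achieving: it has a PIR achievable rate
matrix with `κ / ν = k / n`. -/
def IsMDSPIRCapacityAchieving {k n : ℕ} (G : Matrix (Fin k) (Fin n) F) : Prop :=
  ∃ (κ ν : ℕ) (Λ : Matrix (Fin ν) (Fin n) (ZMod 2)), 0 < ν ∧
    IsPIRAchievableRateMatrix (κ := κ) G Λ ∧ (κ : ℚ) / ν = (k : ℚ) / n

end LinCode

/-! ## PIR schemes for coded storage -/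

/-- A scheme for retrieving one of `f` files, each stored in `β` stripes, from `n` nodes.
Given the index `m` of the requested file, the user draws private randomness (from a law that does
not involve the files) and sends a query to each node; node `l` returns `d l` symbols of `F`,
which are a deterministic function of its query and of the code symbols that it stores (`β` for
each file). -/
structure PIRScheme (F : Type u) (n β f : ℕ) (d : Fin n → ℕ) where
  Query : Fin n → Type u
  [queryFintype : ∀ l, Fintype (Query l)]
  Rand : Type u
  randLaw : PMF Rand
  query : Fin f → Rand → ∀ l, Query l
  answer : ∀ l, Query l → (Fin f → Fin β → F) → (Fin (d l) → F)

attribute [instance] PIRScheme.queryFintype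

namespace PIRScheme

open FiniteEntropy

variable {F : Type u} [Field F] [Fintype F] {n k β f : ℕ} {d : Fin n → ℕ}

/-- The `f` files, each a `β × k` matrix over `F`. -/
abbrev Files (F : Type u) (f β k : ℕ) : Type u := Fin f → Matrix (Fin β) (Fin k) F

/-- All entries of all files are independent and uniform on `F`. -/
def filesLaw (F : Type u) [Field F] [Fintype F] (f β k : ℕ) : PMF (Files F f β k) :=
  PMF.uniformOfFintype (Files F f β k)

/-- The code symbols stored on node `l`: every row of every file is encoded with `G`, and node `l`
keeps the `l`-th coordinate of each codeword. -/
def stored (G : Matrix (Fin k) (Fin n) F) (X : Files F f β k) (l : Fin n) : Fin f → Fin β → F :=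
  fun j i => (X j * G) i l

/-- The response of node `l` when file `m` is requested. -/
def response (S : PIRScheme F n β f d) (G : Matrix (Fin k) (Fin n) F) (m : Fin f) (s : S.Rand)
    (X : Files F f β k) (l : Fin n) : Fin (d l) → F :=
  S.answer l (S.query m s l) (stored G X l)

/-- Law of the pair (user randomness, files), which are independent. -/
def law (S : PIRScheme F n β f d) (k : ℕ) : PMF (S.Rand × Files F f β k) :=
  S.randLaw.bind fun s => (filesLaw F f β k).map fun X => (s, X)

/-- Joint law of (requested index, (user randomness, files)) when the index has law `prior`. -/
def jointLaw (S : PIRScheme F n β f d) (k : ℕ) (prior : PMF (Fin f)) :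
    PMF (Fin f × S.Rand × Files F f β k) :=
  prior.bind fun m => (S.law k).map fun ω => (m, ω)

/-- Privacy: `I(m; Q_l, A_l, X¹, …, X^f) = 0` for each node `l`, whatever the law of the requested
index `m` is. -/
def IsPrivate (S : PIRScheme F n β f d) (G : Matrix (Fin k) (Fin n) F) : Prop :=
  ∀ (prior : PMF (Fin f)) (l : Fin n),
    mutualInfo (S.jointLaw k prior) (fun ω => ω.1)
      (fun ω => (S.query ω.1 ω.2.1 l, S.response G ω.1 ω.2.1 ω.2.2 l, ω.2.2)) = 0

/-- Recovery: `H(X^m | A_1, …, A_n, Q_1, …, Q_n) = 0` for each requested file `m`. -/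
def IsRecovering (S : PIRScheme F n β f d) (G : Matrix (Fin k) (Fin n) F) : Prop :=
  ∀ m : Fin f,
    condEntropy (S.law k) (fun ω => ω.2 m)
      (fun ω => (S.response G m ω.1 ω.2, S.query m ω.1)) = 0

/-- The scheme achieves perfect information-theoretic PIR on the storage system encoded by `G`. -/
def IsPerfectPIR (S : PIRScheme F n β f d) (G : Matrix (Fin k) (Fin n) F) : Prop :=
  S.IsPrivate G ∧ S.IsRecovering G

end PIRScheme

namespace PIR

variable {F : Type u} [Field F] [Fintype F] {n k : ℕ}

/-- The PIR rate `β k / D`, where `D` is the total number of downloaded symbols. -/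
def rate (n k β : ℕ) (d : Fin n → ℕ) : ℝ := ((β * k : ℕ) : ℝ) / ((∑ l, d l : ℕ) : ℝ)

/-- The PIR rate `R` is achievable for `f` files stored with the generator matrix `G`. -/
def Achievable (G : Matrix (Fin k) (Fin n) F) (f : ℕ) (R : ℝ) : Prop :=
  ∃ (β : ℕ) (d : Fin n → ℕ), 0 < β ∧ rate n k β d = R ∧
    ∃ S : PIRScheme F n β f d, S.IsPerfectPIR G

/-- The PIR rate `R` is achievable by a file-independent protocol: one number `β` of stripes and
one choice of the numbers of downloaded symbols serve every number `f` of files. -/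
def FileIndependentAchievable (G : Matrix (Fin k) (Fin n) F) (R : ℝ) : Prop :=
  ∃ (β : ℕ) (d : Fin n → ℕ), 0 < β ∧ rate n k β d = R ∧
    ∀ f : ℕ, 1 ≤ f → ∃ S : PIRScheme F n β f d, S.IsPerfectPIR G

/-- The MDS-PIR capacity `C_f^{[n,k]} = ((n - k) / n) (1 - (k / n)^f)⁻¹`. For `k = n` this is `0/0`
and is read as its limit `1 / f`, so that always `C_f^{[n,k]} = (1 + k/n + ⋯ + (k/n)^(f-1))⁻¹`. -/
def mdsCapacity (f n k : ℕ) : ℝ :=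
  if k = n then 1 / (f : ℝ) else ((n : ℝ) - k) / n * (1 - ((k : ℝ) / n) ^ f)⁻¹

/-- The asymptotic MDS-PIR capacity `C_∞^{[n,k]} = (n - k) / n`. -/
def mdsCapacityInf (n k : ℕ) : ℝ := ((n : ℝ) - k) / n

/-- `R_{f,B} = (∑_p (k_p / k) (C_f^{[n_p,k_p]})⁻¹)⁻¹`. -/
def rateB {P : ℕ} (k : ℕ) (np kp : Fin P → ℕ) (f : ℕ) : ℝ :=
  (∑ p, ((kp p : ℝ) / k) * (mdsCapacity f (np p) (kp p))⁻¹)⁻¹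

/-- `R_{∞,B} = (∑_p (k_p / k) (C_∞^{[n_p,k_p]})⁻¹)⁻¹`. -/
def rateBInf {P : ℕ} (k : ℕ) (np kp : Fin P → ℕ) : ℝ :=
  (∑ p, ((kp p : ℝ) / k) * (mdsCapacityInf (np p) (kp p))⁻¹)⁻¹

end PIR

end

/-!
All schemes used here are linear: node `l` receives coefficients of linear combinations of the
symbols it stores. Such a scheme is perfect as soon as, for each node and each pair of requested
files, a bijection of the user's randomness carries one query into the other, and all-zero answers
force the codewords of the requested file to vanish (`LinearPIR`,
`LinearPIR.toPIRScheme_isPerfectPIR`).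

A PIR achievable rate matrix assigns to node `l` a set `A l` of `κ` of its `ν` row indices, such
that for each row `i` a codeword vanishes if it vanishes at all nodes `l` with `i ∈ A l`
(`LinearPIR.IsCover`). So a codeword attached to row `i` may be downloaded directly at these nodes,
and is then known at the other ones, where it can mask symbols of the requested file. In the same
way a stripe of the requested file attached to row `i` is recovered from its symbols at the nodes
`l` with `i ∈ A l`.

* File-independent protocol (`LinearPIR.IsCover.nonempty_fileIndependent`): the masks are uniformly
  random combinations of all stripes of all files. Each node answers `ν κ` queries and
  `(ν - κ) ν` stripes are retrieved, so that the rate is `1 - κ / ν = 1 - k / n`.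
* Protocol for `f` files (`LinearPIR.IsCover.nonempty_symmetric`): each answer of a node is a sum of
  one stripe symbol from each file of a set `T`. The number of answers for a given `T` does not
  depend on the requested file `m`. For `m ∉ T` the sum is a symbol of a side word; for `m ∈ T` it
  is a symbol of file `m` masked by a side word for `T \ {m}`. The stripes of each file are renamed
  by independent uniform permutations. At a single node the stripes used of any given file are
  distinct, whatever `m` is, and any two injective families are related by a permutation; hence
  privacy. The numbers of side words and answers are chosen so that the recurrence
  (answers for `T ∪ {m}` containing a mask) : (answers for `T`) = `(ν - κ) : κ` holds, and the
  binomial theorem gives `ν ^ f` retrieved stripes and `∑ i < f, κ ^ (i + 1) ν ^ (f - 1 - i)`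
  answers per node.

For a direct sum, the protocols of the components run side by side on a common number of stripes,
each component serving several batches of stripes with the same queries (`LinearPIR.batch`,
`LinearPIR.directSum`). A weight-preserving linear bijection permutes and scales the coordinates
(`LinCode.exists_monomial_of_hammingNorm_eq`), which the user can undo in the queries
(`LinearPIR.comapMonomial`).
-/

/-! ### Vanishing mutual information and conditional entropy -/

namespace FiniteEntropy

variable {Ω : Type u} {α : Type v} {γ : Type w} [Fintype α] [Fintype γ]

theorem sum_toReal_pmf (q : PMF α) : ∑ a, (q a).toReal = 1 := by
  rw [← ENNReal.toReal_sum (fun a _ => q.apply_ne_top a), ← tsum_fintype (L := .unconditional α),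
    q.tsum_coe, ENNReal.toReal_one]

/-- If the joint law is a product law, the mutual information vanishes. -/
theorem mutualInfo_eq_zero_of_map_eq (p : PMF Ω) (X : Ω → α) (Y : Ω → γ) (q : PMF α) (r : PMF γ)
    (h : p.map (fun ω => (X ω, Y ω)) = q.bind fun a => r.map fun y => (a, y)) :
    mutualInfo p X Y = 0 := by
  have hX : p.map X = q := by
    have h1 := congrArg (PMF.map Prod.fst) h
    rw [PMF.map_comp, PMF.map_bind] at h1
    simp only [PMF.map_comp] at h1
    have h2 : ∀ a : α, (r.map (Prod.fst ∘ fun y : γ => (a, y))) = PMF.pure a :=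
      fun a => PMF.map_const r a
    simp only [h2, PMF.bind_pure] at h1
    exact h1
  have hY : p.map Y = r := by
    have h1 := congrArg (PMF.map Prod.snd) h
    rw [PMF.map_comp, PMF.map_bind] at h1
    simp only [PMF.map_comp] at h1
    have h2 : ∀ a : α, (r.map (Prod.snd ∘ fun y : γ => (a, y))) = r :=
      fun a => PMF.map_id r
    simp only [h2, PMF.bind_const] at h1
    exact h1
  have hXY : ∀ a y, p.map (fun ω => (X ω, Y ω)) (a, y) = q a * r y := by
    classical
    intro a y
    rw [h, PMF.bind_apply, tsum_fintype, Finset.sum_eq_single a]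
    · rw [PMF.map_apply, tsum_eq_single y]
      · simp
      · intro y' hy'
        simp [Ne.symm hy']
    · intro a' _ ha'
      rw [PMF.map_apply, ENNReal.tsum_eq_zero.2, mul_zero]
      intro y'
      simp [Ne.symm ha']
    · simp
  have hsum : ∑ x : α × γ, Real.negMulLog ((p.map (fun ω => (X ω, Y ω)) x).toReal)
      = ∑ a, Real.negMulLog (q a).toReal + ∑ y, Real.negMulLog (r y).toReal := by
    rw [Fintype.sum_prod_type]
    simp only [hXY, ENNReal.toReal_mul, Real.negMulLog_mul, Finset.sum_add_distrib]
    simp only [← Finset.sum_mul, ← Finset.mul_sum, sum_toReal_pmf, one_mul]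
  simp only [mutualInfo, entropy]
  rw [hsum, hX, hY, sub_self]

theorem entropy_comp_of_injective (p : PMF Ω) (Y : Ω → γ) {g : γ → α}
    (hg : Function.Injective g) : entropy p (fun ω => g (Y ω)) = entropy p Y := by
  classical
  have hmap : p.map (fun ω => g (Y ω)) = (p.map Y).map g := (PMF.map_comp Y p g).symm
  have happ : ∀ y, (p.map Y).map g (g y) = p.map Y y := by
    intro y
    rw [PMF.map_apply, tsum_eq_single y]
    · simp
    · intro y' hy'
      simp [hg.ne (Ne.symm hy')]
  simp only [entropy, hmap]
  rw [← Finset.sum_subset (Finset.subset_univ (Finset.univ.image g)),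
    Finset.sum_image (fun _ _ _ _ h => hg h)]
  · simp only [happ]
  · intro a _ ha
    have : (p.map Y).map g a = 0 := by
      rw [PMF.map_apply, ENNReal.tsum_eq_zero.2]
      intro y
      rw [if_neg]
      rintro rfl
      simp at ha
    simp [this]

/-- If `X` is a function of `Y`, then `H(X | Y) = 0`: the pair `(X, Y)` is an injective function of
`Y`. -/
theorem condEntropy_eq_zero_of_factorsThrough (p : PMF Ω) (X : Ω → α) (Y : Ω → γ)
    (h : Function.FactorsThrough X Y) : condEntropy p X Y = 0 := by
  obtain ⟨ω₀, -⟩ := p.support_nonempty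
  have : Nonempty α := ⟨X ω₀⟩
  obtain ⟨g, rfl⟩ := (Function.factorsThrough_iff X).1 h
  rw [condEntropy, sub_eq_zero]
  exact entropy_comp_of_injective p Y (g := fun y => (g y, y)) fun a b hab => congrArg Prod.snd hab

end FiniteEntropy

/-! ### Linear protocols -/

/-- A linear PIR protocol for `f` files whose stripes, indexed by `σ`, are encoded with the code
`C`. Node `l` receives the coefficients of `δ l` linear combinations of the symbols it stores.
The query law is that of `query m` under the uniform law on `Rand`; that the law of a single
query does not depend on the requested file is witnessed by bijections of `Rand`. By linearity,
the requested file can be recovered as soon as only stored words with zero requested file are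
answered by zeros. -/
structure LinearPIR {F : Type u} [Field F] {ι : Type} (C : Submodule F (ι → F)) (f : ℕ)
    (σ : Type) [Fintype σ] (δ : ι → Type) where
  Rand : Type u
  [randFintype : Fintype Rand]
  [randNonempty : Nonempty Rand]
  query : Fin f → Rand → ∀ l, δ l → Fin f → σ → F
  exists_equiv : ∀ l m m', ∃ e : Rand ≃ Rand, ∀ s, query m s l = query m' (e s) l
  recover : ∀ m s (c : Fin f → σ → ι → F), (∀ j b, c j b ∈ C) →
    (∀ l i, ∑ j, ∑ b, query m s l i j b * c j b l = 0) → ∀ b, c m b = 0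

namespace LinearPIR

attribute [instance] LinearPIR.randFintype LinearPIR.randNonempty

open Classical in
/-- The PIR scheme defined by a linear protocol, after numbering the stripes and the answers. -/
noncomputable def toPIRScheme {F : Type u} [Field F] [Fintype F] {n f : ℕ}
    {C : Submodule F (Fin n → F)} {σ : Type} [Fintype σ] {δ : Fin n → Type}
    [∀ l, Fintype (δ l)] (L : LinearPIR C f σ δ) :
    PIRScheme F n (Fintype.card σ) f (fun l => Fintype.card (δ l)) where
  Query l := δ l → Fin f → σ → F
  Rand := L.Rand
  randLaw := PMF.uniformOfFintype L.Rand
  query := L.query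
  answer l q y i :=
    ∑ j, ∑ b, q ((Fintype.equivFin (δ l)).symm i) j b * y j (Fintype.equivFin σ b)

variable {F : Type u} [Field F] [Fintype F] {n k f : ℕ} {C : Submodule F (Fin n → F)}
  {σ : Type} [Fintype σ] {δ : Fin n → Type} [∀ l, Fintype (δ l)]

theorem map_uniformOfFintype_equiv {α : Type*} [Fintype α] [Nonempty α] (e : α ≃ α) :
    (PMF.uniformOfFintype α).map e = PMF.uniformOfFintype α := by
  classical
  ext s
  rw [PMF.map_apply, tsum_eq_single (e.symm s)]
  · simp [PMF.uniformOfFintype_apply]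
  · intro s' hs'
    rw [if_neg]
    rintro rfl
    simp at hs'

theorem toPIRScheme_isPrivate (L : LinearPIR C f σ δ) (G : Matrix (Fin k) (Fin n) F) :
    L.toPIRScheme.IsPrivate G := by
  intro prior l
  obtain ⟨m₀, -⟩ := prior.support_nonempty
  set S := L.toPIRScheme
  -- the query and answer of node `l` together with all the files, when file `m` is requested
  let Y : Fin f → S.Rand × PIRScheme.Files F f (Fintype.card σ) k → _ :=
    fun m ω => (S.query m ω.1 l, S.response G m ω.1 ω.2 l, ω.2)
  have hY : ∀ m, (S.law k).map (Y m) = (S.law k).map (Y m₀) := by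
    intro m
    obtain ⟨e, he⟩ : ∃ e : S.Rand ≃ S.Rand, ∀ s, S.query m s l = S.query m₀ (e s) l :=
      L.exists_equiv l m m₀
    have hq : ∀ s X, Y m (s, X) = Y m₀ (e s, X) := by
      intro s X
      simp only [Y, PIRScheme.response, he s]
    have hunif : S.randLaw.map e = S.randLaw := map_uniformOfFintype_equiv (α := L.Rand) e
    unfold PIRScheme.law
    conv_rhs => rw [← hunif]
    rw [PMF.bind_map, PMF.map_bind, PMF.map_bind]
    simp only [PMF.map_comp, Function.comp_def, hq]
  refine FiniteEntropy.mutualInfo_eq_zero_of_map_eq _ _ _ prior ((S.law k).map (Y m₀)) ?_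
  unfold PIRScheme.jointLaw
  rw [PMF.map_bind]
  congr 1
  funext m
  rw [← hY m, PMF.map_comp, PMF.map_comp]
  rfl

theorem toPIRScheme_isRecovering {G : Matrix (Fin k) (Fin n) F} (hG : LinCode.IsGenerator G)
    (L : LinearPIR (LinCode.code G) f σ δ) : L.toPIRScheme.IsRecovering G := by
  intro m
  refine FiniteEntropy.condEntropy_eq_zero_of_factorsThrough _ _ _ ?_
  rintro ⟨s, X⟩ ⟨s', X'⟩ h
  obtain ⟨hA, hQ⟩ := Prod.mk.inj h
  -- by linearity it suffices to look at the difference of the two sets of stored codewords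
  let c : Fin f → σ → Fin n → F := fun j b => ((X j - X' j) * G) (Fintype.equivFin σ b)
  have hrow : ∀ (v : Fin k → F), Matrix.vecMul v G ∈ LinCode.code G := by
    intro v
    rw [Matrix.vecMul_eq_sum]
    exact Submodule.sum_mem _ fun i _ =>
      Submodule.smul_mem _ _ (Submodule.subset_span ⟨i, rfl⟩)
  have hc : ∀ b, c m b = 0 := by
    refine L.recover m s c (fun j b => ?_) fun l i => ?_
    · simp only [c, Matrix.mul_apply_eq_vecMul]
      exact hrow _
    · have h1 := congrFun (congrFun hA l) (Fintype.equivFin (δ l) i)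
      have h2 : L.query m s' l = L.query m s l := (congrFun hQ l).symm
      simp only [PIRScheme.response, PIRScheme.stored, toPIRScheme, Equiv.symm_apply_apply,
        h2] at h1
      simp only [c, Matrix.sub_mul, Matrix.sub_apply, mul_sub,
        Finset.sum_sub_distrib]
      rw [h1, sub_self]
  have hinj : Function.Injective fun v : Fin k → F => Matrix.vecMul v G :=
    Matrix.vecMul_injective_iff.2 hG
  change X m = X' m
  ext b i
  have h0 := hc ((Fintype.equivFin σ).symm b)
  simp only [c, Equiv.apply_symm_apply, Matrix.mul_apply_eq_vecMul] at h0
  have h3 : (X m - X' m) b = 0 := hinj (by simpa using h0)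
  exact sub_eq_zero.1 (congrFun h3 i)

theorem toPIRScheme_isPerfectPIR {G : Matrix (Fin k) (Fin n) F} (hG : LinCode.IsGenerator G)
    (L : LinearPIR (LinCode.code G) f σ δ) : L.toPIRScheme.IsPerfectPIR G :=
  ⟨L.toPIRScheme_isPrivate G, toPIRScheme_isRecovering hG L⟩

end LinearPIR

/-! ### Rate matrices and the file-independent protocol -/

namespace LinearPIR

variable {F : Type u} [Field F] {ι : Type} {C : Submodule F (ι → F)} {ν κ : ℕ}

/-- The family `A` of sets of row indices, one set for each node, has sets of size `κ`, and for each
row `i` the nodes `l` with `i ∈ A l` determine a word of `C`. For the supports of the columns of a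
PIR achievable rate matrix the second condition holds because these nodes contain an information
set. -/
structure IsCover (C : Submodule F (ι → F)) (A : ι → Finset (Fin ν)) (κ : ℕ) : Prop where
  card_eq : ∀ l, (A l).card = κ
  eq_zero : ∀ i, ∀ c ∈ C, (∀ l, i ∈ A l → c l = 0) → c = 0

/-- Retrieval with masks that are uniformly random combinations of all stripes: since a single query
is uniformly distributed, it reveals nothing. Node `l` returns the mask `(i, r)` itself if
`i ∈ A l`, and otherwise adds to it a symbol of the requested file; the stripe `(y, i)` has to be
sent by all nodes `l` with `i ∈ A l`. -/
theorem IsCover.nonempty_fileIndependent [Fintype F] {A : ι → Finset (Fin ν)}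
    (hA : IsCover C A κ) (f : ℕ) :
    Nonempty (LinearPIR C f (Fin (ν - κ) × Fin ν) fun _ => Fin ν × Fin κ) := by
  classical
  have hcard : ∀ l, Fintype.card ({i // i ∉ A l} × Fin κ)
      = Fintype.card (Fin (ν - κ) × {i // i ∈ A l}) := by
    intro l
    simp only [Fintype.card_prod, Fintype.card_subtype_compl, Fintype.card_fin,
      Fintype.card_coe, hA.card_eq]
  let e := fun l => Fintype.equivOfCardEq (hcard l)
  -- coefficients, in the answer `x` of node `l`, of the stripes of the requested file
  let D : ι → Fin ν × Fin κ → Fin (ν - κ) × Fin ν → F := fun l x b =>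
    if h : x.1 ∈ A l then 0
    else if ((e l (⟨x.1, h⟩, x.2)).1, ((e l (⟨x.1, h⟩, x.2)).2 : Fin ν)) = b then 1 else 0
  refine ⟨{
    Rand := Fin ν × Fin κ → Fin f → Fin (ν - κ) × Fin ν → F
    query := fun m s l x j b => s x j b + if j = m then D l x b else 0
    exists_equiv := fun l m m' => ⟨Equiv.addRight fun x j b =>
      (if j = m then D l x b else 0) - (if j = m' then D l x b else 0), fun s => ?_⟩
    recover := fun m s c hc h => ?_ }⟩
  · funext x j b
    simp only [Equiv.coe_addRight, Pi.add_apply]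
    ring
  · have hsum : ∀ l x, ∑ j, ∑ b, (s x j b + if j = m then D l x b else 0) * c j b l
        = (∑ j, ∑ b, s x j b • c j b) l + ∑ b, D l x b * c m b l := by
      intro l x
      simp only [add_mul, Finset.sum_add_distrib, Finset.sum_apply, Pi.smul_apply, smul_eq_mul,
        ite_mul, zero_mul]
      congr 1
      rw [Finset.sum_eq_single m]
      · simp
      · intro j _ hj
        simp [hj]
      · simp
    -- the random words are read off, unmasked, on a set of nodes that determines them
    have hw : ∀ x : Fin ν × Fin κ, ∑ j, ∑ b, s x j b • c j b = 0 := by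
      intro x
      refine hA.eq_zero x.1 _ (Submodule.sum_mem _ fun j _ => Submodule.sum_mem _ fun b _ =>
        Submodule.smul_mem _ _ (hc j b)) fun l hl => ?_
      have h1 := h l x
      rw [hsum] at h1
      simpa [D, hl] using h1
    -- hence the remaining nodes reveal the symbols of the requested file
    rintro ⟨y, i⟩
    refine hA.eq_zero i _ (hc m _) fun l hl => ?_
    obtain ⟨⟨⟨i', hi'⟩, r⟩, hx⟩ := (e l).surjective (y, ⟨i, hl⟩)
    have h1 := h l (i', r)
    rw [hsum, hw] at h1
    simpa [D, hi', hx] using h1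

/-! ### Symmetric retrieval patterns -/

/-- The number of answers of a node that are sums over exactly the files in `T`. -/
def slotCount (κ μ : ℕ) {f : ℕ} (T : Finset (Fin f)) : ℕ :=
  if T = ∅ then 0 else κ ^ (Tᶜ.card + 1) * μ ^ (T.card - 1)

/-- The number of groups of `ν` side words which are sums over exactly the files in `T`. There is one
group of zero words for `T = ∅`: it masks the answers that involve only the requested file. -/
def wordCount (κ μ : ℕ) {f : ℕ} (T : Finset (Fin f)) : ℕ :=
  if T = ∅ then 1 else κ ^ Tᶜ.card * μ ^ (T.card - 1)

/-- The answers of a node, each labelled with the set of files it involves. -/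
abbrev Slot (κ μ f : ℕ) : Type := Σ T : Finset (Fin f), Fin (slotCount κ μ T)

/-- The side words, each labelled with the set of files it involves; its last component is the row
index in `Fin ν`, which tells at which nodes the word is downloaded. -/
abbrev SideWord (ν κ μ f : ℕ) : Type := Σ T : Finset (Fin f), Fin (wordCount κ μ T) × Fin ν

variable {μ f : ℕ}

theorem slotCount_of_notMem (T : Finset (Fin f)) (hT : T ≠ ∅) :
    slotCount κ μ T = wordCount κ μ T * κ := by
  simp only [slotCount, wordCount, if_neg hT]
  ring

theorem slotCount_of_mem (T : Finset (Fin f)) {m : Fin f} (hm : m ∈ T) (hT : T ≠ {m}) :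
    slotCount κ μ T = wordCount κ μ (T.erase m) * μ := by
  have h0 : T ≠ ∅ := Finset.ne_empty_of_mem hm
  have h1 : T.erase m ≠ ∅ := by
    rw [Ne, Finset.erase_eq_empty_iff]
    tauto
  have h2 : (T.erase m).card = T.card - 1 := Finset.card_erase_of_mem hm
  have h3 : (T.erase m)ᶜ.card = Tᶜ.card + 1 := by
    rw [Finset.compl_erase, Finset.card_insert_of_notMem (by simpa using hm)]
  have h4 : 0 < (T.erase m).card := Finset.card_pos.2 (Finset.nonempty_iff_ne_empty.2 h1)
  simp only [slotCount, wordCount, if_neg h0, if_neg h1, h2, h3]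
  rw [mul_assoc, ← pow_succ]
  congr 2
  omega

/-- The binomial theorem, for the subsets that contain `m`. -/
theorem sum_wordCount (m : Fin f) :
    ∑ T : Finset (Fin f) with m ∈ T, wordCount κ μ T = (κ + μ) ^ (f - 1) := by
  have hc : (Finset.univ.erase m).card = f - 1 := by simp
  rw [add_comm, ← hc, ← Finset.sum_pow_mul_eq_add_pow]
  refine Finset.sum_nbij' (fun T => T.erase m) (fun T => insert m T) ?_ ?_ ?_ ?_ ?_
  · intro T _
    simpa using Finset.erase_subset_erase m (Finset.subset_univ T)
  · simp
  · intro T hT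
    exact Finset.insert_erase (by simpa using hT)
  · intro T hT
    refine Finset.erase_insert fun h => ?_
    simpa using Finset.mem_powerset.1 hT h
  · intro T hT
    have hm : m ∈ T := by simpa using hT
    have h0 : T ≠ ∅ := Finset.ne_empty_of_mem hm
    have h1 : 0 < T.card := Finset.card_pos.2 ⟨m, hm⟩
    rw [wordCount, if_neg h0, Finset.card_erase_of_mem hm, hc, mul_comm, Finset.card_compl,
      Fintype.card_fin]
    congr 2
    omega

theorem sum_slotCount_of_mem (m : Fin f) :
    ∑ T : Finset (Fin f) with m ∈ T, slotCount κ μ T = (κ + μ) ^ (f - 1) * κ := by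
  rw [← sum_wordCount m, Finset.sum_mul]
  refine Finset.sum_congr rfl fun T hT => slotCount_of_notMem T ?_
  exact Finset.ne_empty_of_mem (a := m) (by simpa using hT)

theorem sum_nonempty_subsets {α : Type*} [DecidableEq α] (s : Finset α) :
    ∑ T ∈ s.powerset, (if T = ∅ then 0 else κ ^ ((s \ T).card + 1) * μ ^ (T.card - 1))
      = ∑ i ∈ Finset.range s.card, κ ^ (i + 1) * (κ + μ) ^ (s.card - 1 - i) := by
  induction s using Finset.induction_on with
  | empty => simp
  | insert a s ha ih =>
    rw [Finset.sum_powerset_insert ha, Finset.card_insert_of_notMem ha, Finset.sum_range_succ']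
    congr 1
    · calc _ = ∑ T ∈ s.powerset,
              κ * (if T = ∅ then 0 else κ ^ ((s \ T).card + 1) * μ ^ (T.card - 1)) := by
            refine Finset.sum_congr rfl fun T hT => ?_
            have haT : a ∉ T := fun h => ha (Finset.mem_powerset.1 hT h)
            rw [Finset.insert_sdiff_of_notMem _ haT, Finset.card_insert_of_notMem (by simp [ha])]
            split_ifs <;> ring
        _ = _ := by
            rw [← Finset.mul_sum, ih, Finset.mul_sum]
            refine Finset.sum_congr rfl fun i _ => ?_
            rw [show s.card + 1 - 1 - (i + 1) = s.card - 1 - i by omega]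
            ring
    · have h1 : ∀ T ∈ s.powerset, (if insert a T = ∅ then 0 else
          κ ^ ((insert a s \ insert a T).card + 1) * μ ^ ((insert a T).card - 1))
          = κ * (μ ^ T.card * κ ^ (s.card - T.card)) := by
        intro T hT
        have hTs := Finset.mem_powerset.1 hT
        have haT : a ∉ T := fun h => ha (hTs h)
        rw [if_neg (Finset.insert_ne_empty a T), Finset.card_insert_of_notMem haT,
          Finset.insert_sdiff_insert, Finset.sdiff_insert_of_notMem ha,
          Finset.card_sdiff_of_subset hTs, Nat.add_sub_cancel]
        ring
      rw [Finset.sum_congr rfl h1, ← Finset.mul_sum, Finset.sum_pow_mul_eq_add_pow]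
      simp [add_comm]

theorem card_slot :
    Fintype.card (Slot κ μ f) = ∑ i ∈ Finset.range f, κ ^ (i + 1) * (κ + μ) ^ (f - 1 - i) := by
  have h := sum_nonempty_subsets (κ := κ) (μ := μ) (Finset.univ : Finset (Fin f))
  rw [Finset.powerset_univ, Finset.card_univ, Fintype.card_fin] at h
  rw [← h, Fintype.card_sigma]
  simp only [Fintype.card_fin, slotCount, Finset.compl_eq_univ_sdiff]

theorem card_sigma_subtype {α : Type*} [Fintype α] {X : α → Type*} [∀ a, Fintype (X a)]
    (p : α → Prop) [DecidablePred p] :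
    Fintype.card {x : Σ a, X a // p x.1} = ∑ a with p a, Fintype.card (X a) := by
  rw [Fintype.card_congr (Equiv.subtypeSigmaEquiv X p), Fintype.card_sigma]
  exact (Finset.sum_subtype _ (by simp) fun a => Fintype.card (X a)).symm

theorem exists_injOn_of_card_le {α β : Type*} [Fintype β] [Nonempty β] (p : α → Prop)
    [Fintype {x // p x}] (h : Fintype.card {x // p x} ≤ Fintype.card β) :
    ∃ g : α → β, Set.InjOn g {x | p x} := by
  classical
  obtain ⟨e⟩ := Function.Embedding.nonempty_of_card_le h
  refine ⟨fun x => if hx : p x then e ⟨x, hx⟩ else Classical.arbitrary β, fun x hx y hy hxy => ?_⟩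
  simp only [Set.mem_ofPred_eq] at hx hy
  simpa [hx, hy] using hxy

theorem exists_perm_of_injOn {α β : Type*} [Finite β] {s : Set α} {g h : α → β}
    (hg : Set.InjOn g s) (hh : Set.InjOn h s) : ∃ π : Equiv.Perm β, ∀ a ∈ s, π (g a) = h a := by
  classical
  have := Fintype.ofFinite β
  let e : {b // b ∈ g '' s} ≃ {b // b ∈ h '' s} :=
    (Equiv.Set.imageOfInjOn g s hg).symm.trans (Equiv.Set.imageOfInjOn h s hh)
  refine ⟨e.extendSubtype, fun a ha => ?_⟩
  rw [e.extendSubtype_apply_of_mem _ ⟨a, ha, rfl⟩]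
  have : (Equiv.Set.imageOfInjOn g s hg).symm ⟨g a, a, ha, rfl⟩ = ⟨a, ha⟩ :=
    (Equiv.symm_apply_eq _).2 rfl
  simp only [e, Equiv.trans_apply, this]
  rfl

/-- For the answers of one node over exactly the files in `T`: the assignment of side words, where
`B` is the set of row indices of the node. If `m ∉ T`, the answers list the side words for `T` with
row index in `B`; if `m ∈ T`, they use distinct masks for `T \ {m}` with row index outside `B`. -/
theorem exists_sideWord_of_slot_fiber (m : Fin f) {B : Finset (Fin ν)} (hB : B.card = κ)
    (hκ : 0 < κ) (T : Finset (Fin f)) :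
    ∃ w : Fin (slotCount κ (ν - κ) T) → SideWord ν κ (ν - κ) f,
      (∀ x, (w x).1 = T.erase m) ∧
      (T ≠ {m} → ∀ x, (w x).2.2 ∈ B ↔ m ∉ T) ∧ (T ≠ {m} → Function.Injective w) ∧
      (m ∉ T → T ≠ ∅ → ∀ y : SideWord ν κ (ν - κ) f, y.1 = T → y.2.2 ∈ B → ∃ x, w x = y) := by
  classical
  by_cases hm : m ∈ T
  · by_cases hT : T = {m}
    · subst hT
      obtain ⟨i, -⟩ := Finset.card_pos.1 (hB ▸ hκ)
      exact ⟨fun _ => ⟨∅, ⟨0, by simp [wordCount]⟩, i⟩, by simp, by simp, by simp, by simp⟩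
    · have hcard : Fintype.card (Fin (slotCount κ (ν - κ) T))
          = Fintype.card (Fin (wordCount κ (ν - κ) (T.erase m)) × {i // i ∉ B}) := by
        simp only [Fintype.card_prod, Fintype.card_subtype_compl, Fintype.card_fin,
          Fintype.card_coe, hB]
        exact slotCount_of_mem T hm hT
      let e := Fintype.equivOfCardEq hcard
      refine ⟨fun x => ⟨T.erase m, (e x).1, (e x).2⟩, fun _ => rfl, fun _ x => ?_,
        fun _ x y hxy => ?_, fun h => absurd hm h⟩
      · simp [hm, (e x).2.2]
      · have h1 := eq_of_heq (Sigma.mk.inj hxy).2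
        exact e.injective (Prod.ext (Prod.mk.inj h1).1 (Subtype.ext (Prod.mk.inj h1).2))
  · by_cases h0 : T = ∅
    · have hemp : IsEmpty (Fin (slotCount κ (ν - κ) T)) := by
        simp only [slotCount, if_pos h0]
        infer_instance
      exact ⟨fun x => hemp.elim x, fun x => hemp.elim x, fun _ x => hemp.elim x,
        fun _ x => hemp.elim x, fun _ h => absurd h0 h⟩
    · have hcard : Fintype.card (Fin (slotCount κ (ν - κ) T))
          = Fintype.card (Fin (wordCount κ (ν - κ) T) × {i // i ∈ B}) := by
        simp only [Fintype.card_prod, Fintype.card_fin, Fintype.card_coe, hB]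
        exact slotCount_of_notMem T h0
      let e := Fintype.equivOfCardEq hcard
      refine ⟨fun x => ⟨T, (e x).1, (e x).2⟩, fun _ => (Finset.erase_eq_of_notMem hm).symm,
        fun _ x => ?_, fun _ x y hxy => ?_, ?_⟩
      · simp [hm, (e x).2.2]
      · have h1 := eq_of_heq (Sigma.mk.inj hxy).2
        exact e.injective (Prod.ext (Prod.mk.inj h1).1 (Subtype.ext (Prod.mk.inj h1).2))
      · rintro _ _ ⟨_, z, i⟩ rfl hi
        exact ⟨e.symm (z, ⟨i, hi⟩), by simp⟩

/-- The side words occurring in the answers of a node when file `m` is requested. The answers that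
involve any given other file use distinct side words, and every side word that involves some file,
but not `m`, and has row index in `B` is downloaded unmasked. -/
theorem exists_sideWord_of_slot (m : Fin f) {B : Finset (Fin ν)} (hB : B.card = κ)
    (hκ : 0 < κ) :
    ∃ w : Slot κ (ν - κ) f → SideWord ν κ (ν - κ) f,
      (∀ x, (w x).1 = x.1.erase m) ∧
      (∀ j, j ≠ m → Set.InjOn w {x | j ∈ x.1}) ∧
      (∀ y : SideWord ν κ (ν - κ) f, m ∉ y.1 → y.1 ≠ ∅ → y.2.2 ∈ B →
        ∃ x, m ∉ x.1 ∧ w x = y) := by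
  choose w h1 h2 h3 h4 using fun T => exists_sideWord_of_slot_fiber m hB hκ T
  refine ⟨fun x => w x.1 x.2, fun x => h1 _ _, ?_, ?_⟩
  · rintro j hj ⟨T, x⟩ hT ⟨T', x'⟩ hT' hxx
    simp only [Set.mem_ofPred_eq] at hT hT' hxx
    have hne : ∀ S : Finset (Fin f), j ∈ S → S ≠ {m} := by
      rintro S hS rfl
      exact hj (by simpa using hS)
    have he : T.erase m = T'.erase m := by rw [← h1 T x, hxx, h1]
    have hm : m ∉ T ↔ m ∉ T' := by rw [← h2 T (hne T hT) x, hxx, h2 T' (hne T' hT')]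
    have hTT : T = T' := by
      ext i
      by_cases hi : i = m
      · subst hi
        tauto
      · have := Finset.ext_iff.1 he i
        simpa [hi] using this
    subst hTT
    rw [h3 T (hne T hT) hxx]
  · intro y hm hy hB'
    obtain ⟨x, hx⟩ := h4 y.1 hm hy y rfl hB'
    exact ⟨⟨y.1, x⟩, hm, hx⟩

/-- The stripes of the requested file `m` in the answers of a node: distinct stripes, exhausting those
with row index in `B`. -/
theorem exists_desired_of_slot (m : Fin f) {B : Finset (Fin ν)} (hB : B.card = κ)
    (hκ : 0 < κ) :
    ∃ h : Slot κ (ν - κ) f → Fin (ν ^ (f - 1)) × Fin ν,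
      Set.InjOn h {x | m ∈ x.1} ∧ ∀ y, ∀ i ∈ B, ∃ x, m ∈ x.1 ∧ h x = (y, i) := by
  classical
  have hν : κ ≤ ν := by simpa [hB] using B.card_le_univ
  have hcard : Fintype.card {x : Slot κ (ν - κ) f // m ∈ x.1}
      = Fintype.card (Fin (ν ^ (f - 1)) × {i // i ∈ B}) := by
    rw [card_sigma_subtype (fun T : Finset (Fin f) => m ∈ T)]
    simp only [Fintype.card_prod, Fintype.card_fin, Fintype.card_coe, hB]
    rw [sum_slotCount_of_mem, Nat.add_sub_cancel' hν]
  let e := Fintype.equivOfCardEq hcard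
  obtain ⟨i₀, -⟩ := Finset.card_pos.1 (hB ▸ hκ)
  have y₀ : Fin (ν ^ (f - 1)) := ⟨0, Nat.pow_pos (by omega)⟩
  refine ⟨fun x => if hx : m ∈ x.1 then ((e ⟨x, hx⟩).1, (e ⟨x, hx⟩).2) else (y₀, i₀), ?_, ?_⟩
  · intro x hx y hy hxy
    simp only [Set.mem_ofPred_eq] at hx hy
    simp only [hx, hy, dif_pos, Prod.mk.injEq] at hxy
    exact congrArg Subtype.val (e.injective (Prod.ext hxy.1 (Subtype.ext hxy.2)))
  · intro y i hi
    refine ⟨(e.symm (y, ⟨i, hi⟩)).1, (e.symm (y, ⟨i, hi⟩)).2, ?_⟩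
    exact (dif_pos (e.symm (y, ⟨i, hi⟩)).2).trans (by simp)

/-- There are enough stripes to use a new one of file `j` for each side word that involves file `j`. -/
theorem exists_stripe_of_sideWord (hκ : 0 < κ) (hν : κ ≤ ν) (j : Fin f) :
    ∃ g : SideWord ν κ (ν - κ) f → Fin (ν ^ (f - 1)) × Fin ν, Set.InjOn g {x | j ∈ x.1} := by
  classical
  have : NeZero ν := ⟨by omega⟩
  refine exists_injOn_of_card_le _ (le_of_eq ?_)
  rw [card_sigma_subtype (fun T : Finset (Fin f) => j ∈ T)]
  simp only [Fintype.card_prod, Fintype.card_fin]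
  rw [← Finset.sum_mul, sum_wordCount, Nat.add_sub_cancel' hν]

/-- Retrieval by sums over sets of files, with the stripes of each file randomly permuted. -/
theorem IsCover.nonempty_symmetric {A : ι → Finset (Fin ν)}
    (hA : IsCover C A κ) (hκ : 0 < κ) (hν : κ ≤ ν) (f : ℕ) :
    Nonempty (LinearPIR C f (Fin (ν ^ (f - 1)) × Fin ν) fun _ => Slot κ (ν - κ) f) := by
  classical
  choose w hw1 hw2 hw3 using fun (m : Fin f) l => exists_sideWord_of_slot m (hA.card_eq l) hκ
  choose h hh1 hh2 using fun (m : Fin f) l => exists_desired_of_slot m (hA.card_eq l) hκ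
  choose g hg using fun j : Fin f => exists_stripe_of_sideWord hκ hν j
  -- the stripe of file `j` in the answer `x` of node `l`, before permuting the stripes
  let base : Fin f → ι → Fin f → Slot κ (ν - κ) f → Fin (ν ^ (f - 1)) × Fin ν :=
    fun m l j x => if j = m then h m l x else g j (w m l x)
  have hbase : ∀ m l j, Set.InjOn (base m l j) {x | j ∈ x.1} := by
    intro m l j
    by_cases hj : j = m
    · subst hj
      simpa [base] using hh1 j l
    · simp only [base, if_neg hj]
      refine (hg j).comp (hw2 m l j hj) fun x hx => ?_
      simpa [hw1, hj] using hx
  refine ⟨{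
    Rand := ULift.{u} (Fin f → Equiv.Perm (Fin (ν ^ (f - 1)) × Fin ν))
    query := fun m s l x j b => if j ∈ x.1 ∧ s.down j (base m l j x) = b then 1 else 0
    exists_equiv := fun l m m' => ?_
    recover := fun m s c hc hz => ?_ }⟩
  · choose ρ hρ using fun j => exists_perm_of_injOn (hbase m' l j) (hbase m l j)
    refine ⟨Equiv.ulift.trans ((Equiv.mulRight ρ).trans Equiv.ulift.symm), fun s => ?_⟩
    funext x j b
    by_cases hj : j ∈ x.1
    · have := hρ j x hj
      simp [hj, this]
    · simp [hj]
  · -- the side words, as codewords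
    let v : SideWord ν κ (ν - κ) f → ι → F := fun y =>
      ∑ j, if j ∈ y.1 then c j (s.down j (g j y)) else 0
    have hsum : ∀ l (x : Slot κ (ν - κ) f),
        (∑ j, ∑ b, (if j ∈ x.1 ∧ s.down j (base m l j x) = b then 1 else 0) * c j b l)
          = (if m ∈ x.1 then c m (s.down m (h m l x)) l else 0) + v (w m l x) l := by
      intro l x
      have h1 : ∀ j, (∑ b, (if j ∈ x.1 ∧ s.down j (base m l j x) = b then 1 else 0) * c j b l)
          = (if j = m then (if m ∈ x.1 then c m (s.down m (h m l x)) l else 0) else 0)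
            + (if j ∈ (w m l x).1 then c j (s.down j (g j (w m l x))) else 0 : ι → F) l := by
        intro j
        rw [hw1]
        by_cases hj : j = m
        · subst hj
          by_cases hx : j ∈ x.1 <;> simp [hx, base]
        · by_cases hx : j ∈ x.1 <;> simp [hx, hj, base]
      simp only [h1, Finset.sum_add_distrib, v, Finset.sum_apply]
      simp
    -- a side word without file `m` is downloaded at nodes that determine it
    have hv : ∀ y : SideWord ν κ (ν - κ) f, m ∉ y.1 → v y = 0 := by
      intro y hm
      by_cases hy : y.1 = ∅
      · simp [v, hy]
      refine hA.eq_zero y.2.2 _ (Submodule.sum_mem _ fun j _ => ?_) fun l hl => ?_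
      · split_ifs
        · exact hc _ _
        · exact zero_mem _
      · obtain ⟨x, hx, rfl⟩ := hw3 m l y hm hy hl
        have h1 := hz l x
        rw [hsum, if_neg hx, zero_add] at h1
        exact h1
    intro b
    obtain ⟨⟨y, i⟩, rfl⟩ := (s.down m).surjective b
    refine hA.eq_zero i _ (hc m _) fun l hl => ?_
    obtain ⟨x, hx, hxy⟩ := hh2 m l y i hl
    have h1 := hz l x
    rw [hsum, if_pos hx, hv _ (by simp [hw1]), hxy] at h1
    simpa using h1

end LinearPIR

/-! ### Batches of stripes, direct sums and monomial maps -/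

namespace LinearPIR

variable {F : Type u} [Field F] {f : ℕ}

open Classical in
/-- Serving several batches of stripes, indexed by `τ`, with the same queries. -/
noncomputable def batch {ι : Type} {C : Submodule F (ι → F)} {σ σ' τ : Type} [Fintype σ]
    [Fintype σ'] [Fintype τ] {δ : ι → Type} (L : LinearPIR C f σ δ) (e : σ' ≃ σ × τ) :
    LinearPIR C f σ' (fun l => δ l × τ) where
  Rand := L.Rand
  query m s l x j b := if (e b).2 = x.2 then L.query m s l x.1 j (e b).1 else 0
  exists_equiv l m m' := by
    obtain ⟨ε, hε⟩ := L.exists_equiv l m m'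
    exact ⟨ε, fun s => by simp only [hε s]⟩
  recover m s c hc h := by
    intro b
    obtain ⟨⟨b, t⟩, rfl⟩ := e.symm.surjective b
    refine L.recover m s (fun j b => c j (e.symm (b, t))) (fun j b => hc _ _) (fun l i => ?_) b
    rw [← h l (i, t)]
    refine Finset.sum_congr rfl fun j _ => ?_
    rw [← e.symm.sum_comp, Fintype.sum_prod_type]
    simp

/-- Protocols for the components of a direct sum, run side by side. -/
def directSum {P : ℕ} {np : Fin P → ℕ} {C : ∀ p, Submodule F (Fin (np p) → F)}
    {D : Submodule F ((Σ p, Fin (np p)) → F)} {σ : Type} [Fintype σ]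
    {δ : ∀ p, Fin (np p) → Type} (L : ∀ p, LinearPIR (C p) f σ (δ p))
    (hD : ∀ x ∈ D, ∀ p, (fun l => x ⟨p, l⟩) ∈ C p) :
    LinearPIR D f σ (fun l => δ l.1 l.2) where
  Rand := ∀ p, (L p).Rand
  query m s l := (L l.1).query m (s l.1) l.2
  exists_equiv l m m' := by
    obtain ⟨ε, hε⟩ := (L l.1).exists_equiv l.2 m m'
    classical
    refine ⟨Equiv.piCongrRight fun p => if h : p = l.1 then h ▸ ε else Equiv.refl _, fun s => ?_⟩
    simpa using hε (s l.1)
  recover m s c hc h := by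
    intro b
    funext l
    exact congrFun ((L l.1).recover m (s l.1) (fun j b l' => c j b ⟨l.1, l'⟩)
      (fun j b => hD _ (hc j b) _) (fun l' i => h ⟨l.1, l'⟩ i) b) l.2

/-- A protocol for a code serves every code that a monomial map embeds into it. -/
def comapMonomial {ι ι' : Type} {C : Submodule F (ι → F)} {D : Submodule F (ι' → F)}
    {σ : Type} [Fintype σ] {δ : ι' → Type} (L : LinearPIR D f σ δ)
    (φ : (ι → F) ≃ₗ[F] (ι' → F)) (hφ : ∀ x ∈ C, φ x ∈ D) (t : ι ≃ ι') (a : ι → F)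
    (hta : ∀ x i, φ x (t i) = a i * x i) : LinearPIR C f σ (fun l => δ (t l)) where
  Rand := L.Rand
  query m s l i j b := L.query m s (t l) i j b * a l
  exists_equiv l m m' := by
    obtain ⟨ε, hε⟩ := L.exists_equiv (t l) m m'
    exact ⟨ε, fun s => by simp only [hε s]⟩
  recover m s c hc h := by
    intro b
    refine (map_eq_zero_iff φ φ.injective).1
      (L.recover m s (fun j b => φ (c j b)) (fun j b => hφ _ (hc j b)) (fun l i => ?_) b)
    obtain ⟨l, rfl⟩ := t.surjective l
    simpa only [hta, mul_assoc] using h l i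

end LinearPIR

/-! ### Linear codes -/

namespace LinCode

variable {F : Type u} [Field F]

/-- A weight-preserving linear bijection is monomial: it maps unit vectors to vectors of weight one. -/
theorem exists_monomial_of_hammingNorm_eq {ι ι' : Type} [Fintype ι] [Fintype ι']
    [DecidableEq F] (φ : (ι → F) ≃ₗ[F] (ι' → F))
    (h : ∀ x, hammingNorm (φ x) = hammingNorm x) :
    ∃ (t : ι ≃ ι') (a : ι → F), ∀ x i, φ x (t i) = a i * x i := by
  classical
  have h1 : ∀ i, ∃ i' c, φ (Pi.single i 1) = Pi.single i' c := by
    intro i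
    have hn : hammingNorm (φ (Pi.single i 1)) = 1 := by
      rw [h, hammingNorm, Finset.card_eq_one]
      refine ⟨i, ?_⟩
      ext i'
      by_cases hi : i' = i
      · subst hi
        simp
      · simp [hi]
    obtain ⟨i', hi'⟩ := Finset.card_eq_one.1 hn
    refine ⟨i', φ (Pi.single i 1) i', ?_⟩
    funext l
    by_cases hl : l = i'
    · subst hl
      simp
    · have : l ∉ ({i'} : Finset ι') := by simpa using hl
      rw [← hi'] at this
      simpa [hl] using this
  choose t a hta using h1
  have ha : ∀ i, a i ≠ 0 := by
    intro i hi
    have := hta i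
    rw [hi, Pi.single_zero, map_eq_zero_iff φ φ.injective] at this
    simpa using congrFun this i
  have ht : Function.Injective t := by
    intro i i' hii
    by_contra hne
    -- otherwise the images of two unit vectors would be proportional
    have h2 : φ (Pi.single i (a i') - Pi.single i' (a i)) = 0 := by
      have hs : ∀ (l : ι) (c : F), (Pi.single l c : ι → F) = c • Pi.single l 1 := by
        intro l c
        rw [← Pi.single_smul, smul_eq_mul, mul_one]
      rw [hs i, hs i', map_sub, map_smul, map_smul, hta, hta, hii, ← Pi.single_smul,
        ← Pi.single_smul, smul_eq_mul, smul_eq_mul, mul_comm, sub_self]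
    rw [map_eq_zero_iff φ φ.injective] at h2
    have := congrFun h2 i
    simp [hne, ha i'] at this
  have hcard : Fintype.card ι = Fintype.card ι' := by
    simpa using φ.finrank_eq
  have hb : Function.Bijective t := (Fintype.bijective_iff_injective_and_card t).2 ⟨ht, hcard⟩
  refine ⟨Equiv.ofBijective t hb, a, fun x i => ?_⟩
  have hx : φ x = ∑ l, x l • φ (Pi.single l 1) := by
    conv_lhs => rw [pi_eq_sum_univ' x]
    simp only [map_sum, map_smul]
  rw [hx, Finset.sum_apply, Finset.sum_eq_single i]
  · simp [hta, mul_comm]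
  · intro l _ hl
    have : t i ≠ t l := ht.ne (Ne.symm hl)
    simp [hta, this]
  · simp

theorem eq_zero_of_isInformationSet {k n : ℕ} {G : Matrix (Fin k) (Fin n) F}
    {I : Finset (Fin n)} (hI : IsInformationSet G I) {c : Fin n → F} (hc : c ∈ code G)
    (h0 : ∀ l ∈ I, c l = 0) : c = 0 := by
  obtain ⟨e, he⟩ := hI
  obtain ⟨v, rfl⟩ := (Submodule.mem_span_range_iff_exists_fun F).1 hc
  have hv : v = 0 := by
    refine Matrix.vecMul_injective_iff_isUnit.2 he ?_
    funext i
    have := h0 (e i) (e i).2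
    rw [Finset.sum_apply] at this
    simpa [Matrix.vecMul, dotProduct, Matrix.row] using this
  simp [hv]

theorem component_mem_code {P : ℕ} {np kp : Fin P → ℕ}
    (Gp : ∀ p, Matrix (Fin (kp p)) (Fin (np p)) F) {x : (Σ p, Fin (np p)) → F}
    (hx : x ∈ code (Matrix.blockDiagonal' Gp)) (p : Fin P) :
    (fun l => x ⟨p, l⟩) ∈ code (Gp p) := by
  let π : ((Σ p, Fin (np p)) → F) →ₗ[F] (Fin (np p) → F) :=
    LinearMap.funLeft F F fun l => ⟨p, l⟩
  suffices h : code (Matrix.blockDiagonal' Gp) ≤ (code (Gp p)).comap π from h hx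
  refine Submodule.span_le.2 ?_
  rintro _ ⟨⟨q, i⟩, rfl⟩
  change (fun l => Matrix.blockDiagonal' Gp ⟨q, i⟩ ⟨p, l⟩) ∈ code (Gp p)
  by_cases hq : q = p
  · subst hq
    simp only [Matrix.blockDiagonal'_apply_eq]
    exact Submodule.subset_span ⟨i, rfl⟩
  · simp only [Matrix.blockDiagonal'_apply_ne Gp i _ hq]
    exact zero_mem _

theorem IsMDSPIRCapacityAchieving.exists_isCover {k n : ℕ} {G : Matrix (Fin k) (Fin n) F}
    (hG : IsGenerator G) (hk : 1 ≤ k) (h : IsMDSPIRCapacityAchieving G) :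
    ∃ (κ ν : ℕ) (A : Fin n → Finset (Fin ν)), 0 < κ ∧ κ ≤ ν ∧ 0 < n ∧ κ * n = k * ν ∧
      LinearPIR.IsCover (code G) A κ := by
  obtain ⟨κ, ν, Λ, hν, ⟨hcol, hrow⟩, hrat⟩ := h
  have hkn : k ≤ n := by simpa using hG.fintype_card_le_finrank
  have hn : 0 < n := by omega
  have hmul : κ * n = k * ν := by
    rw [div_eq_div_iff (by positivity) (by positivity)] at hrat
    exact_mod_cast hrat
  have hκ : 0 < κ := Nat.pos_of_mul_pos_right (b := n) (by rw [hmul]; positivity)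
  refine ⟨κ, ν, fun l => Finset.univ.filter fun i => Λ i l ≠ 0, hκ, ?_, hn, hmul, hcol, ?_⟩
  · rw [← hcol ⟨0, hn⟩]
    exact (Finset.card_le_univ _).trans_eq (by simp)
  · intro i c hc hl
    obtain ⟨I, hI, hIΛ⟩ := hrow i
    exact eq_zero_of_isInformationSet hI hc fun l hlI => hl l (by simpa using hIΛ l hlI)

end LinCode

/-! ### Rates -/

namespace PIR

variable {F : Type u} [Field F]

/-- The geometric sum covers the case `k = n` as well. -/
theorem inv_mdsCapacity {n k : ℕ} (hn : 0 < n) (f : ℕ) :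
    (mdsCapacity f n k)⁻¹ = ∑ i ∈ Finset.range f, ((k : ℝ) / n) ^ i := by
  have hn' : (n : ℝ) ≠ 0 := by positivity
  unfold mdsCapacity
  split_ifs with h
  · subst h
    simp [div_self hn']
  · have h1 : (k : ℝ) ≠ n := by exact_mod_cast h
    have h2 : (k : ℝ) / n ≠ 1 := by rwa [Ne, div_eq_one_iff_eq hn']
    rw [geom_sum_eq h2, mul_inv, inv_inv, inv_div]
    have h3 : (n : ℝ) - k ≠ 0 := sub_ne_zero.2 (Ne.symm h1)
    have h4 : (k : ℝ) / n - 1 ≠ 0 := sub_ne_zero.2 h2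
    rw [eq_div_iff h4]
    field_simp
    ring

open LinCode in
/-- `n * card δ` is the total download and `card σ` the number of stripes, so the rate is the
MDS-PIR capacity. -/
theorem exists_linearPIR_mdsCapacity {k n : ℕ} {G : Matrix (Fin k) (Fin n) F}
    (hG : IsGenerator G) (hk : 1 ≤ k) (h : IsMDSPIRCapacityAchieving G) {f : ℕ} (hf : 1 ≤ f) :
    ∃ (σ : Type) (_ : Fintype σ) (δ : Type) (_ : Fintype δ), 0 < Fintype.card σ ∧
      (n * Fintype.card δ : ℝ) = Fintype.card σ * (k * (mdsCapacity f n k)⁻¹) ∧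
      Nonempty (LinearPIR (code G) f σ fun _ => δ) := by
  obtain ⟨κ, ν, A, hκ, hν, hn, hmul, hA⟩ := h.exists_isCover hG hk
  have hν0 : 0 < ν := by omega
  refine ⟨_, inferInstance, _, inferInstance, ?_, ?_, hA.nonempty_symmetric hκ hν f⟩
  · simp only [Fintype.card_prod, Fintype.card_fin]
    positivity
  · have hr : (k : ℝ) / n = κ / ν := by
      rw [div_eq_div_iff (by positivity) (by positivity)]
      exact_mod_cast hmul.symm
    have hk' : (k : ℝ) = n * (κ / ν) := by
      rw [← hr]
      field_simp
    rw [LinearPIR.card_slot, inv_mdsCapacity hn, hr, Nat.add_sub_cancel' hν, hk']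
    simp only [Fintype.card_prod, Fintype.card_fin]
    push_cast
    rw [Finset.mul_sum, Finset.mul_sum, Finset.mul_sum]
    refine Finset.sum_congr rfl fun i hi => ?_
    obtain ⟨t, rfl⟩ : ∃ t, f = i + 1 + t := Nat.exists_eq_add_of_le (Finset.mem_range.1 hi)
    rw [div_pow, show i + 1 + t - 1 - i = t by omega, show i + 1 + t - 1 = i + t by omega]
    field_simp
    ring

open LinCode in
/-- The numbers of stripes and of answers serve all numbers `f` of files. -/
theorem exists_linearPIR_mdsCapacityInf [Fintype F] {k n : ℕ} {G : Matrix (Fin k) (Fin n) F}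
    (hG : IsGenerator G) (hk : 1 ≤ k) (h : IsMDSPIRCapacityAchieving G) (hkn : k < n) :
    ∃ (σ : Type) (_ : Fintype σ) (δ : Type) (_ : Fintype δ), 0 < Fintype.card σ ∧
      (n * Fintype.card δ : ℝ) = Fintype.card σ * (k * (mdsCapacityInf n k)⁻¹) ∧
      ∀ f, Nonempty (LinearPIR (code G) f σ fun _ => δ) := by
  obtain ⟨κ, ν, A, hκ, hν, hn, hmul, hA⟩ := h.exists_isCover hG hk
  have hlt : κ < ν := by nlinarith
  refine ⟨_, inferInstance, _, inferInstance, ?_, ?_, hA.nonempty_fileIndependent⟩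
  · simp only [Fintype.card_prod, Fintype.card_fin]
    exact Nat.mul_pos (by omega) (by omega)
  · have h1 : (n : ℝ) - k ≠ 0 := by
      rw [sub_ne_zero]
      exact_mod_cast hkn.ne'
    have hmul' : (κ * n : ℝ) = k * ν := by exact_mod_cast hmul
    simp only [Fintype.card_prod, Fintype.card_fin, mdsCapacityInf]
    rw [inv_div]
    push_cast [Nat.cast_sub hν]
    field_simp
    linear_combination (ν : ℝ) * hmul'

/-- Protocols for the components, with `r p` downloaded symbols per stripe, combine to a protocol for
any code isometric to the direct sum, with `∑ p, r p` downloaded symbols per stripe. The number of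
stripes is the product of those of the components. -/
theorem exists_linearPIR_of_isometric {n P : ℕ} {np : Fin P → ℕ}
    {C : Submodule F (Fin n → F)} {Cp : ∀ p, Submodule F (Fin (np p) → F)}
    {D : Submodule F ((Σ p, Fin (np p)) → F)} (hD : ∀ x ∈ D, ∀ p, (fun l => x ⟨p, l⟩) ∈ Cp p)
    (hiso : LinCode.Isometric C D) (σ δ : Fin P → Type) [∀ p, Fintype (σ p)]
    [∀ p, Fintype (δ p)] (hσ : ∀ p, 0 < Fintype.card (σ p)) (r : Fin P → ℝ)
    (hr : ∀ p, (np p * Fintype.card (δ p) : ℝ) = Fintype.card (σ p) * r p) :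
    ∃ (τ : Type) (_ : Fintype τ) (ε : Fin n → Type) (_ : ∀ l, Fintype (ε l)),
      0 < Fintype.card τ ∧
      ((∑ l, Fintype.card (ε l) : ℕ) : ℝ) = Fintype.card τ * ∑ p, r p ∧
      ∀ f, (∀ p, Nonempty (LinearPIR (Cp p) f (σ p) fun _ => δ p)) →
        Nonempty (LinearPIR C f τ ε) := by
  classical
  obtain ⟨φ, hφ, rfl⟩ := hiso
  obtain ⟨t, a, hta⟩ := LinCode.exists_monomial_of_hammingNorm_eq φ (by convert hφ)
  refine ⟨∀ p, σ p, inferInstance,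
    fun l => δ (t l).1 × (∀ q : {q // q ≠ (t l).1}, σ q), inferInstance, ?_, ?_, ?_⟩
  · rw [Fintype.card_pi]
    exact Finset.prod_pos fun p _ => hσ p
  · rw [t.sum_comp fun x => Fintype.card (δ x.1 × (∀ q : {q // q ≠ x.1}, σ q)),
      Fintype.sum_sigma, Nat.cast_sum, Finset.mul_sum]
    refine Finset.sum_congr rfl fun p _ => ?_
    rw [Fintype.card_congr (Equiv.piSplitAt p σ)]
    trans ((∑ _x : Fin (np p),
      Fintype.card (δ p) * Fintype.card (∀ q : {q // q ≠ p}, σ q) : ℕ) : ℝ)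
    · exact congrArg Nat.cast (Finset.sum_congr rfl fun x _ => Fintype.card_prod _ _)
    simp only [Fintype.card_prod]
    push_cast
    rw [Finset.sum_const, Finset.card_univ, Fintype.card_fin, nsmul_eq_mul, ← mul_assoc, hr]
    ring
  · intro f hL
    exact ⟨(LinearPIR.directSum (fun p => (hL p).some.batch (Equiv.piSplitAt p σ))
      hD).comapMonomial φ (fun x hx => Submodule.mem_map_of_mem hx) t a hta⟩

theorem rate_eq {n k β : ℕ} (hβ : 0 < β) (d : Fin n → ℕ) {P : ℕ} (kp : Fin P → ℕ)
    (R : Fin P → ℝ) (hd : ((∑ l, d l : ℕ) : ℝ) = β * ∑ p, kp p * R p) :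
    rate n k β d = (∑ p, ((kp p : ℝ) / k) * R p)⁻¹ := by
  have h1 : ∑ p, ((kp p : ℝ) / k) * R p = (∑ p, kp p * R p) / k := by
    rw [Finset.sum_div]
    exact Finset.sum_congr rfl fun p _ => by ring
  rw [h1, inv_div, rate, hd]
  push_cast
  exact mul_div_mul_left _ _ (by positivity)

theorem tendsto_rateB {k P : ℕ} (hk : k ≠ 0) (hP : 1 ≤ P) (np kp : Fin P → ℕ)
    (hkp : ∀ p, 1 ≤ kp p) (hlt : ∀ p, kp p < np p) :
    Tendsto (fun f : ℕ => rateB k np kp f) atTop (𝓝 (rateBInf k np kp)) := by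
  have hpos : ∀ p, 0 < mdsCapacityInf (np p) (kp p) := by
    intro p
    have h1 : (kp p : ℝ) < np p := by exact_mod_cast hlt p
    have h2 : (0 : ℝ) < np p := lt_of_le_of_lt (by positivity) h1
    exact div_pos (sub_pos.2 h1) h2
  refine Tendsto.inv₀ (tendsto_finsetSum _ fun p _ =>
    (Tendsto.inv₀ ?_ (hpos p).ne').const_mul _) (ne_of_gt ?_)
  · have h1 : (kp p : ℝ) < np p := by exact_mod_cast hlt p
    have h2 : (0 : ℝ) < np p := lt_of_le_of_lt (by positivity) h1
    have h3 := tendsto_pow_atTop_nhds_zero_of_lt_one (r := (kp p : ℝ) / np p) (by positivity)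
      ((div_lt_one h2).2 h1)
    simp only [mdsCapacity, if_neg (hlt p).ne]
    have h4 := ((h3.const_sub 1).inv₀ (by simp)).const_mul (((np p : ℝ) - kp p) / np p)
    simpa [mdsCapacityInf] using h4
  · have : Nonempty (Fin P) := ⟨⟨0, hP⟩⟩
    refine Finset.sum_pos (fun p _ => ?_) Finset.univ_nonempty
    have := hpos p
    have := hkp p
    positivity

end PIR

theorem mainTheorem3 {F : Type u} [Field F] [Fintype F] {n k : ℕ}
    (G : Matrix (Fin k) (Fin n) F) (hG : LinCode.IsGenerator G)
    {P : ℕ} (hP : 1 ≤ P) (np kp : Fin P → ℕ)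
    (Gp : ∀ p, Matrix (Fin (kp p)) (Fin (np p)) F)
    (hkp : ∀ p, 1 ≤ kp p)
    (hGp : ∀ p, LinCode.IsGenerator (Gp p))
    (hcap : ∀ p, LinCode.IsMDSPIRCapacityAchieving (Gp p))
    (hiso : LinCode.Isometric (LinCode.code G) (LinCode.code (Matrix.blockDiagonal' Gp))) :
    (∀ f : ℕ, 1 ≤ f → PIR.Achievable G f (PIR.rateB k np kp f)) ∧
    ((∀ p, kp p < np p) →
      Tendsto (fun f : ℕ => PIR.rateB k np kp f) atTop (𝓝 (PIR.rateBInf k np kp)) ∧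
      PIR.FileIndependentAchievable G (PIR.rateBInf k np kp)) := by
  have hD := fun x hx p => LinCode.component_mem_code Gp (x := x) hx p
  have hk : k ≠ 0 := by
    rintro rfl
    -- the direct sum is nonzero, as the rows of the `Gp p` are
    have h0 : LinCode.code G = ⊥ := by simp [LinCode.code]
    obtain ⟨φ, -, hφ⟩ := hiso
    rw [h0, Submodule.map_bot] at hφ
    let p : Fin P := ⟨0, hP⟩
    let i : Fin (kp p) := ⟨0, hkp p⟩
    have hrow : (Matrix.blockDiagonal' Gp).row ⟨p, i⟩ = 0 := by
      rw [← Submodule.mem_bot F, hφ]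
      exact Submodule.subset_span ⟨_, rfl⟩
    refine (hGp p).ne_zero i (funext fun l => ?_)
    simpa [Matrix.row] using congrFun hrow ⟨p, l⟩
  refine ⟨fun f hf => ?_, fun hlt => ⟨PIR.tendsto_rateB hk hP np kp hkp hlt, ?_⟩⟩
  · choose σ _ δ _ hσ hr hL using
      fun p => PIR.exists_linearPIR_mdsCapacity (hGp p) (hkp p) (hcap p) hf
    obtain ⟨τ, _, ε, _, hτ, hd, hT⟩ := PIR.exists_linearPIR_of_isometric hD hiso σ δ hσ _ hr
    obtain ⟨L⟩ := hT f hL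
    exact ⟨_, _, hτ, PIR.rate_eq hτ _ kp _ hd, _, L.toPIRScheme_isPerfectPIR hG⟩
  · choose σ _ δ _ hσ hr hL using
      fun p => PIR.exists_linearPIR_mdsCapacityInf (hGp p) (hkp p) (hcap p) (hlt p)
    obtain ⟨τ, _, ε, _, hτ, hd, hT⟩ := PIR.exists_linearPIR_of_isometric hD hiso σ δ hσ _ hr
    refine ⟨_, _, hτ, PIR.rate_eq hτ _ kp _ hd, fun f _ => ?_⟩
    obtain ⟨L⟩ := hT f fun p => hL p f
    exact ⟨_, L.toPIRScheme_isPerfectPIR hG⟩
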